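/- Let $p\ge 1$, let $\theta=(\theta_1,\dots,\theta_p)'\in\mathbb R^p$ and $\rho\in\mathbb R$ satisfy $\|\theta\|_1=\sum_{i=1}^p|\theta_i|<1$ and $|\rho|<1$. Let $(V_n)_{n\ge1}$ be a sequence of square-integrable, independent and identically distributed real random variables with zero mean and variance $\sigma^2>0$, and let $X_0=\varepsilon_0$ be a square-integrable random variable, $X_{-1}=X_{-2}=\dots=X_{-p}=0$. Let $(X_n)$ be the AR($p$) process driven by AR(1) noise given, for all $n\ge1$, by $$X_n=\theta_1X_{n-1}+\dots+\theta_pX_{n-p}+\varepsilon_n,\qquad \varepsilon_n=\rho\,\varepsilon_{n-1}+V_n.$$ For $n\ge0$ put $\Phi_n=(X_n,X_{n-1},\dots,X_{n-p+1})'$ and $S_n=\sum_{k=0}^n\Phi_k\Phi_k'+S$, where $S$ is a fixed real symmetric positive definite $p\times p$ matrix, and for $n\ge1$ let $$\widehat\theta_n=(S_{n-1})^{-1}\sum_{k=1}^n\Phi_{k-1}X_k$$ be the least squares estimator of $\theta$. Then $$\lim_{n\to\infty}\widehat\theta_n=\theta^*\quad\text{almost surely},\qquad \theta^*=\alpha\,(I_p-\theta_p\rho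 J_p)\,\beta,$$ where $I_p$ is the identity matrix, $J_p$ is the exchange matrix of order $p$ (ones on the antidiagonal, zeros elsewhere), $$\alpha=\frac{1}{(1-\theta_p\rho)(1+\theta_p\rho)},\qquad \beta=(\theta_1+\rho,\ \theta_2-\theta_1\rho,\ \dots,\ \theta_p-\theta_{p-1}\rho)'.$$ -/

import Mathlib

open MeasureTheory ProbabilityTheory Filter Topology

namespace ARNoise

/-- A trajectory of the AR(p) process driven by AR(1) noise. The coordinate `θ i` (with `i : Fin p`
counted from `0`) is the coefficient usually written `θ_{i+1}`, and multiplies `X_{n-(i+1)}`.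
The initial values are `X_0 = ε_0` and `X_{-1} = ⋯ = X_{-p} = 0`; both recursions hold for all
`n ≥ 1`. The values `v 0` and `x m`, `m < -p`, play no role. -/
structure IsTrajectory {p : ℕ} (θ : Fin p → ℝ) (ρ : ℝ) (x : ℤ → ℝ) (ε v : ℕ → ℝ) : Prop where
  init_zero : x 0 = ε 0
  init_neg : ∀ m : ℤ, -(p : ℤ) ≤ m → m < 0 → x m = 0
  process : ∀ n : ℕ, 1 ≤ n → x n = ∑ i : Fin p, θ i * x ((n : ℤ) - ((i : ℤ) + 1)) + ε n
  noise : ∀ n : ℕ, 1 ≤ n → ε n = ρ * ε (n - 1) + v n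

/-- The lag vector `Φ_n = (X_n, X_{n-1}, …, X_{n-p+1})`. -/
def lagVector (p : ℕ) (x : ℤ → ℝ) (n : ℤ) : Fin p → ℝ := fun i => x (n - (i : ℤ))

/-- `S_n = ∑_{k=0}^n Φ_k Φ_k' + S`. -/
def gramMatrix {p : ℕ} (S : Matrix (Fin p) (Fin p) ℝ) (x : ℤ → ℝ) (n : ℕ) :
    Matrix (Fin p) (Fin p) ℝ :=
  ∑ k ∈ Finset.range (n + 1),
    Matrix.vecMulVec (lagVector p x (k : ℤ)) (lagVector p x (k : ℤ)) + S

/-- The least squares estimator `(S_{n-1})⁻¹ ∑_{k=1}^n Φ_{k-1} X_k`, meant for `n ≥ 1`. -/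
noncomputable def lsEstimator {p : ℕ} (S : Matrix (Fin p) (Fin p) ℝ) (x : ℤ → ℝ) (n : ℕ) :
    Fin p → ℝ :=
  Matrix.mulVec (gramMatrix S x (n - 1))⁻¹
    (∑ k ∈ Finset.Icc 1 n, x (k : ℤ) • lagVector p x ((k : ℤ) - 1))

/-- The exchange matrix `J_p`, with ones on the antidiagonal and zeros elsewhere. -/
def exchangeMatrix (p : ℕ) : Matrix (Fin p) (Fin p) ℝ :=
  Matrix.of fun i j => if (i : ℕ) + (j : ℕ) + 1 = p then 1 else 0

/-- The last coordinate `θ_p`. -/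
def lastCoeff {p : ℕ} [NeZero p] (θ : Fin p → ℝ) : ℝ :=
  θ ⟨p - 1, Nat.sub_one_lt (NeZero.ne p)⟩

/-- `α = 1 / ((1 - θ_p ρ) (1 + θ_p ρ))`. -/
noncomputable def alpha {p : ℕ} [NeZero p] (θ : Fin p → ℝ) (ρ : ℝ) : ℝ :=
  1 / ((1 - lastCoeff θ * ρ) * (1 + lastCoeff θ * ρ))

/-- `β = (θ_1 + ρ, θ_2 - θ_1 ρ, …, θ_p - θ_{p-1} ρ)`. -/
def beta {p : ℕ} (θ : Fin p → ℝ) (ρ : ℝ) : Fin p → ℝ := fun i =>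
  if (i : ℕ) = 0 then θ i + ρ
  else θ i - θ ⟨(i : ℕ) - 1, lt_of_le_of_lt (Nat.sub_le _ _) i.isLt⟩ * ρ

/-- The limiting value `θ* = α (I_p - θ_p ρ J_p) β`. -/
noncomputable def thetaStar {p : ℕ} [NeZero p] (θ : Fin p → ℝ) (ρ : ℝ) : Fin p → ℝ :=
  alpha θ ρ •
    Matrix.mulVec (1 - (lastCoeff θ * ρ) • exchangeMatrix p) (beta θ ρ)

end ARNoise

/-! The proof is pathwise. The strong law gives almost surely that the averages of `V_k ^ 2` tend to
`σ ^ 2` and those of `V_{k+j} V_k` to `0` for each `j ≥ 1`; the rest is deterministic.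

Along an ultrafilter finer than `atTop`, averages of products of tame sequences converge and define
a semi-inner product `ip`, invariant under delay. Since `∑ |θ_i| < 1` and `|ρ| < 1`, the past of the
process is orthogonal to the current innovation (`ip_shift_eq_zero_of_recursion`). So the limiting
Gram matrix `Γ` is invertible (`isUnit_det_limitGram`).

Eliminating the noise turns `X` into an AR(`p + 1`) process with coefficients `β` and `-τ`, where `τ
= θ_p ρ`. With `γ` the autocovariances at lags `1, …, p`, its Yule–Walker equations read `Γ β = (I +
τ J) γ`. As `Γ` is symmetric Toeplitz it commutes with `J`, whence `Γ θ* = γ`. The limit is thus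
`Γ⁻¹ γ = θ*` for every ultrafilter, which gives convergence along `atTop`. -/

namespace ARNoise

/-! ### Tame sequences and their stability under autoregression. -/

/-- Sequences indexed by `ℤ`, vanishing at negative times, whose squares have bounded averages
and grow slower than linearly. -/
structure IsTame (a : ℤ → ℝ) : Prop where
  zero_neg : ∀ m < 0, a m = 0
  sum_sq_le : ∃ C, ∀ n : ℕ, ∑ k ∈ Finset.range n, a k ^ 2 ≤ C * n
  sq_le : ∀ δ > 0, ∃ C, ∀ n : ℕ, a n ^ 2 ≤ δ * n + C

/-- The sequence delayed by `j` time steps. -/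
def shift (j : ℕ) (a : ℤ → ℝ) : ℤ → ℝ := fun m => a (m - j)

@[simp] theorem shift_zero (a : ℤ → ℝ) : shift 0 a = a := by
  ext m; simp [shift]

theorem shift_shift (i j : ℕ) (a : ℤ → ℝ) : shift i (shift j a) = shift (i + j) a := by
  ext m; simp only [shift]; congr 1; push_cast; ring

theorem sum_shift_le {f : ℤ → ℝ} (h0 : ∀ m, 0 ≤ f m) (hneg : ∀ m < 0, f m = 0) (j N : ℕ) :
    ∑ k ∈ Finset.range N, f ((k : ℤ) - j) ≤ ∑ k ∈ Finset.range N, f k := by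
  induction j with
  | zero => simp
  | succ j ih =>
    refine le_trans ?_ ih
    cases N with
    | zero => simp
    | succ N =>
      rw [Finset.sum_range_succ', Finset.sum_range_succ, hneg (((0 : ℕ) : ℤ) - (j + 1 : ℕ))
        (by push_cast; omega)]
      refine add_le_add (le_of_eq (Finset.sum_congr rfl fun k _ => ?_)) (h0 _)
      congr 1; push_cast; ring

theorem IsTame.comp_shift {a : ℤ → ℝ} (ha : IsTame a) (j : ℕ) : IsTame (shift j a) := by
  refine ⟨fun m hm => ha.zero_neg _ (by omega), ?_, fun δ hδ => ?_⟩
  · obtain ⟨C, hC⟩ := ha.sum_sq_le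
    exact ⟨C, fun n => (sum_shift_le (f := fun m => a m ^ 2) (fun m => sq_nonneg _)
      (fun m hm => by simp [ha.zero_neg m hm]) j n).trans (hC n)⟩
  · obtain ⟨C, hC⟩ := ha.sq_le δ hδ
    refine ⟨C, fun n => ?_⟩
    have hC0 : 0 ≤ C := by simpa using (sq_nonneg _).trans (hC 0)
    by_cases h : n < j
    · rw [shift, ha.zero_neg _ (by omega)]
      nlinarith [mul_nonneg hδ.le (Nat.cast_nonneg n : (0 : ℝ) ≤ n)]
    · have := hC (n - j)
      rw [shift]
      push_cast [not_lt.1 h] at this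
      nlinarith [(Nat.cast_nonneg j : (0 : ℝ) ≤ j)]

/-- Convexity of the square, with weights `|θ i|` and `1 - ∑ i, |θ i|`. -/
theorem sq_sum_add_le {ι : Type*} [Fintype ι] (θ y : ι → ℝ) (u : ℝ) (hs : ∑ i, |θ i| < 1) :
    (∑ i, θ i * y i + u) ^ 2 ≤ ∑ i, |θ i| * y i ^ 2 + u ^ 2 / (1 - ∑ i, |θ i|) := by
  set s := ∑ i, |θ i| with hsdef
  set P := ∑ i, |θ i| * y i ^ 2 with hP
  set T := ∑ i, θ i * y i with hT
  have hTP : T ^ 2 ≤ s * P :=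
    Finset.sum_sq_le_sum_mul_sum_of_sq_le_mul _ (fun i _ => abs_nonneg _)
      (fun i _ => by positivity) (fun i _ => (by rw [mul_pow, ← sq_abs (θ i)]; ring : _ = _).le)
  have hs0 : 0 ≤ s := Finset.sum_nonneg fun i _ => abs_nonneg _
  have hP0 : 0 ≤ P := Finset.sum_nonneg fun i _ => by positivity
  have h1 : 0 < 1 - s := by linarith
  have key : (T + u) ^ 2 * (1 - s) ≤ P * (1 - s) + u ^ 2 := by
    rcases hs0.eq_or_lt with h | h
    · rw [← h] at hTP ⊢
      have : T = 0 := by nlinarith [sq_nonneg T]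
      rw [this]; nlinarith
    -- Since `T ^ 2 ≤ s * P`, this product is at least `((1 - s) * T - s * u) ^ 2`.
    · have : 0 ≤ s * (P * (1 - s) + u ^ 2 - (T + u) ^ 2 * (1 - s)) := by
        nlinarith [sq_nonneg ((1 - s) * T - s * u), mul_le_mul_of_nonneg_left hTP h1.le]
      nlinarith [nonneg_of_mul_nonneg_right this h]
  rw [← sub_nonneg]
  have : P + u ^ 2 / (1 - s) - (T + u) ^ 2 =
      (P * (1 - s) + u ^ 2 - (T + u) ^ 2 * (1 - s)) / (1 - s) := by
    field_simp
  rw [this]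
  exact div_nonneg (by linarith) h1.le

/-- A stable autoregression driven by a tame sequence is tame. -/
theorem IsTame.of_recursion {p : ℕ} {θ : Fin p → ℝ} (hs : ∑ i, |θ i| < 1) {y u : ℤ → ℝ}
    (hneg : ∀ m < 0, y m = 0) (hy : ∀ m, y m = ∑ i, θ i * shift ((i : ℕ) + 1) y m + u m)
    (hu : IsTame u) : IsTame y := by
  have h1 : 0 < 1 - ∑ i, |θ i| := by linarith
  have hsq (m : ℤ) : y m ^ 2 ≤ ∑ i, |θ i| * shift ((i : ℕ) + 1) y m ^ 2
      + u m ^ 2 / (1 - ∑ i, |θ i|) := by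
    have := sq_sum_add_le θ (fun i => shift ((i : ℕ) + 1) y m) (u m) hs
    rwa [← hy m] at this
  refine ⟨hneg, ?_, fun δ hδ => ?_⟩
  · obtain ⟨C, hC⟩ := hu.sum_sq_le
    -- With `s = ∑ |θ i|` and `A` the sum of squares, summing `hsq` gives `A ≤ s A + C n / (1 - s)`;
    -- solving for `A` costs a second factor `1 - s`.
    refine ⟨C / (1 - ∑ i, |θ i|) / (1 - ∑ i, |θ i|), fun n => ?_⟩
    have hA : ∑ k ∈ Finset.range n, y k ^ 2 ≤ (∑ i, |θ i|) * ∑ k ∈ Finset.range n, y k ^ 2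
        + C * n / (1 - ∑ i, |θ i|) := by
      refine (Finset.sum_le_sum fun (k : ℕ) _ => hsq k).trans ?_
      rw [Finset.sum_add_distrib, Finset.sum_comm, ← Finset.sum_div, Finset.sum_mul]
      refine add_le_add (Finset.sum_le_sum fun i _ => ?_)
        (div_le_div_of_nonneg_right (hC n) h1.le)
      rw [← Finset.mul_sum]
      exact mul_le_mul_of_nonneg_left (sum_shift_le (f := fun m => y m ^ 2)
        (fun m => sq_nonneg _) (fun m hm => by simp [hneg m hm]) _ n) (abs_nonneg _)
    rw [div_mul_eq_mul_div, le_div_iff₀ h1, div_mul_eq_mul_div]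
    linarith
  -- The factor `(1 - s) ^ 2` makes the driving term at most `(1 - s) M`, so the induction closes
  -- with `s M + (1 - s) M = M`.
  · obtain ⟨C, hC⟩ := hu.sq_le (δ * (1 - ∑ i, |θ i|) ^ 2) (by positivity)
    have hC0 : 0 ≤ C := by simpa using (sq_nonneg _).trans (hC 0)
    refine ⟨C / (1 - ∑ i, |θ i|) ^ 2, fun n => ?_⟩
    induction n using Nat.strong_induction_on with
    | _ n ih =>
      set M := δ * n + C / (1 - ∑ i, |θ i|) ^ 2 with hM
      have hM0 : 0 ≤ M := by positivity
      have hlag (i : Fin p) : shift ((i : ℕ) + 1) y n ^ 2 ≤ M := by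
        by_cases h : n < (i : ℕ) + 1
        · rw [shift, hneg _ (by omega)]; simpa using hM0
        · have := ih (n - ((i : ℕ) + 1)) (by omega)
          rw [Nat.cast_sub (not_lt.1 h), Nat.cast_sub (not_lt.1 h)] at this
          refine this.trans ?_
          rw [hM]
          gcongr
          have : (0 : ℝ) ≤ (((i : ℕ) + 1 : ℕ) : ℝ) := Nat.cast_nonneg _
          linarith
      have hu' : u n ^ 2 / (1 - ∑ i, |θ i|) ≤ (1 - ∑ i, |θ i|) * M := by
        rw [div_le_iff₀ h1, hM]
        refine (hC n).trans (le_of_eq ?_)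
        field_simp
      calc y n ^ 2 ≤ ∑ i, |θ i| * shift ((i : ℕ) + 1) y n ^ 2 + u n ^ 2 / (1 - ∑ i, |θ i|) := hsq n
        _ ≤ ∑ i, |θ i| * M + (1 - ∑ i, |θ i|) * M := by
          gcongr with i
          exact hlag i
        _ = M := by rw [← Finset.sum_mul]; ring

/-! ### The semi-inner product along an ultrafilter. -/

/-- The limit of `(1/n) ∑_{k<n} a_k b_k` along an ultrafilter. -/
noncomputable def ip (U : Ultrafilter ℕ) (a b : ℤ → ℝ) : ℝ :=
  limUnder (U : Filter ℕ) fun n : ℕ => (∑ k ∈ Finset.range n, a k * b k) / n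

variable {U : Ultrafilter ℕ}

/-- The averages stay in a compact interval, where every ultrafilter converges. -/
theorem tendsto_ip {a b : ℤ → ℝ} (ha : IsTame a) (hb : IsTame b) :
    Tendsto (fun n : ℕ => (∑ k ∈ Finset.range n, a k * b k) / n) U (𝓝 (ip U a b)) := by
  obtain ⟨A, hA⟩ := ha.sum_sq_le
  obtain ⟨B, hB⟩ := hb.sum_sq_le
  apply tendsto_nhds_limUnder
  have hA0 : 0 ≤ A := by simpa using (Finset.sum_nonneg fun k _ => sq_nonneg _).trans (hA 1)
  have hB0 : 0 ≤ B := by simpa using (Finset.sum_nonneg fun k _ => sq_nonneg _).trans (hB 1)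
  have hmem : ∀ n : ℕ, (∑ k ∈ Finset.range n, a k * b k) / n ∈ Set.Icc (-(A + B)) (A + B) := by
    intro n
    rw [Set.mem_Icc, ← abs_le]
    rcases n.eq_zero_or_pos with rfl | hn
    · simpa using add_nonneg hA0 hB0
    · have hn' : (0 : ℝ) < n := by exact_mod_cast hn
      rw [abs_div, Nat.abs_cast, div_le_iff₀ hn']
      calc |∑ k ∈ Finset.range n, a k * b k| ≤ ∑ k ∈ Finset.range n, |a k * b k| :=
            Finset.abs_sum_le_sum_abs _ _
        _ ≤ ∑ k ∈ Finset.range n, (a k ^ 2 + b k ^ 2) := by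
            refine Finset.sum_le_sum fun k _ => ?_
            rw [abs_mul, ← sq_abs (a k), ← sq_abs (b k)]
            nlinarith [sq_nonneg (|a k| - |b k|), sq_nonneg |a k|, sq_nonneg |b k|]
        _ ≤ (A + B) * n := by
            rw [Finset.sum_add_distrib, add_mul]; exact add_le_add (hA n) (hB n)
  obtain ⟨l, -, hl⟩ := isCompact_Icc.ultrafilter_le_nhds
    (U.map fun n : ℕ => (∑ k ∈ Finset.range n, a k * b k) / n)
    (le_principal_iff.2 (Filter.mem_map.2 (Filter.univ_mem' hmem)))
  exact ⟨l, hl⟩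

theorem ip_eq_of_tendsto {a b : ℤ → ℝ} {l : ℝ}
    (h : Tendsto (fun n : ℕ => (∑ k ∈ Finset.range n, a k * b k) / n) U (𝓝 l)) :
    ip U a b = l := h.limUnder_eq

theorem ip_comm (a b : ℤ → ℝ) : ip U a b = ip U b a := by
  simp only [ip, mul_comm]

theorem ip_combination {ι : Type*} [Fintype ι] {a d b : ℤ → ℝ} {c : ι → ℝ} {f : ι → ℤ → ℝ}
    (h : ∀ m, a m = ∑ i, c i * f i m + d m) (hf : ∀ i, IsTame (f i)) (hd : IsTame d)
    (hb : IsTame b) : ip U a b = ∑ i, c i * ip U (f i) b + ip U d b := by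
  apply ip_eq_of_tendsto
  have hsum : Tendsto (fun n : ℕ => ∑ i, c i * ((∑ k ∈ Finset.range n, f i k * b k) / n)) U
      (𝓝 (∑ i, c i * ip U (f i) b)) :=
    tendsto_finsetSum Finset.univ fun i _ => (tendsto_ip (hf i) hb).const_mul (c i)
  refine (hsum.add (tendsto_ip hd hb)).congr fun n => ?_
  simp only [h, add_mul, Finset.sum_add_distrib, Finset.sum_mul, add_div]
  congr 1
  rw [Finset.sum_comm, Finset.sum_div]
  refine Finset.sum_congr rfl fun i _ => ?_
  rw [← mul_div_assoc, Finset.mul_sum]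
  simp only [mul_assoc]

theorem abs_ip_le {a b : ℤ → ℝ} (ha : IsTame a) (hb : IsTame b) :
    |ip U a b| ≤ ip U a a + ip U b b := by
  refine le_of_tendsto_of_tendsto (tendsto_ip ha hb).abs
    ((tendsto_ip ha ha).add (tendsto_ip hb hb)) (Eventually.of_forall fun n => ?_)
  simp only
  rw [abs_div, Nat.abs_cast, ← add_div, ← Finset.sum_add_distrib]
  gcongr
  refine (Finset.abs_sum_le_sum_abs _ _).trans (Finset.sum_le_sum fun k _ => ?_)
  rw [abs_mul, ← abs_mul_abs_self (a k), ← abs_mul_abs_self (b k)]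
  nlinarith [sq_nonneg (|a k| - |b k|), sq_nonneg |a k|, sq_nonneg |b k|]

theorem ip_sq_le {a b : ℤ → ℝ} (ha : IsTame a) (hb : IsTame b) :
    ip U a b ^ 2 ≤ ip U a a * ip U b b := by
  refine le_of_tendsto_of_tendsto ((tendsto_ip ha hb).pow 2)
    ((tendsto_ip ha ha).mul (tendsto_ip hb hb)) (Eventually.of_forall fun n => ?_)
  simp only
  rw [div_pow, div_mul_div_comm, ← sq (n : ℝ)]
  gcongr
  simp only [← sq]
  exact Finset.sum_mul_sq_le_sq_mul_sq _ _ _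

/-- Sublinear growth of the squares makes a single boundary term negligible; this is what shift
invariance of `ip` rests on. -/
theorem tendsto_mul_div (hU : (U : Filter ℕ) ≤ atTop) {a b : ℤ → ℝ} (ha : IsTame a)
    (hb : IsTame b) : Tendsto (fun n : ℕ => a n * b n / n) U (𝓝 0) := by
  refine Tendsto.mono_left ?_ hU
  rw [Metric.tendsto_atTop]
  intro δ hδ
  obtain ⟨A, hA⟩ := ha.sq_le (δ / 4) (by positivity)
  obtain ⟨B, hB⟩ := hb.sq_le (δ / 4) (by positivity)
  obtain ⟨N, hN⟩ := exists_nat_gt ((A + B) / (δ / 2))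
  refine ⟨N + 1, fun n hn => ?_⟩
  have hn' : (0 : ℝ) < n := by exact_mod_cast (by omega : 0 < n)
  have hNn : (N : ℝ) ≤ n := by exact_mod_cast (by omega : N ≤ n)
  rw [div_lt_iff₀ (by positivity)] at hN
  rw [Real.dist_eq, sub_zero, abs_div, Nat.abs_cast, div_lt_iff₀ hn', abs_mul]
  have h1 := hA n
  have h2 := hB n
  rw [← sq_abs] at h1 h2
  nlinarith [sq_nonneg (|a n| - |b n|), sq_nonneg |a n|, sq_nonneg |b n|]

theorem tendsto_ip_succ (hU : (U : Filter ℕ) ≤ atTop) {a b : ℤ → ℝ} (ha : IsTame a)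
    (hb : IsTame b) :
    Tendsto (fun n : ℕ => (∑ k ∈ Finset.range (n + 1), a k * b k) / n) U (𝓝 (ip U a b)) := by
  simpa [Finset.sum_range_succ, add_div] using (tendsto_ip ha hb).add (tendsto_mul_div hU ha hb)

/-- Since `a` vanishes at `-1`, the delayed sum over `n + 1` terms is the original sum over `n`
terms. -/
theorem ip_shift_one (hU : (U : Filter ℕ) ≤ atTop) {a b : ℤ → ℝ} (ha : IsTame a)
    (hb : IsTame b) : ip U (shift 1 a) (shift 1 b) = ip U a b := by
  refine tendsto_nhds_unique (tendsto_ip_succ hU (ha.comp_shift 1) (hb.comp_shift 1))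
    ((tendsto_ip ha hb).congr fun n => ?_)
  rw [Finset.sum_range_succ']
  simp [shift, ha.zero_neg (-1) (by norm_num)]

theorem ip_shift (hU : (U : Filter ℕ) ≤ atTop) {a b : ℤ → ℝ} (ha : IsTame a)
    (hb : IsTame b) (j : ℕ) : ip U (shift j a) (shift j b) = ip U a b := by
  induction j with
  | zero => simp
  | succ j ih =>
    rw [← ih, ← ip_shift_one hU (ha.comp_shift j) (hb.comp_shift j), shift_shift, shift_shift, add_comm]

theorem ip_shift_add (hU : (U : Filter ℕ) ≤ atTop) {a b : ℤ → ℝ} (ha : IsTame a)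
    (hb : IsTame b) (i j k : ℕ) :
    ip U (shift (i + k) a) (shift (j + k) b) = ip U (shift i a) (shift j b) := by
  rw [← ip_shift hU (ha.comp_shift i) (hb.comp_shift j) k, shift_shift, shift_shift, add_comm k,
    add_comm k]

/-- A bounded solution of a contracting forward recursion vanishes. -/
theorem eq_zero_of_forward_recursion {p : ℕ} {θ : Fin p → ℝ} (hs : ∑ i, |θ i| < 1) {h : ℕ → ℝ}
    {C : ℝ} (hC : ∀ i, |h i| ≤ C) (hrec : ∀ i, h i = ∑ j, θ j * h (i + (j + 1))) (i : ℕ) :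
    h i = 0 := by
  have hpow : ∀ n i, |h i| ≤ (∑ j, |θ j|) ^ n * C := by
    intro n
    induction n with
    | zero => simpa using hC
    | succ n ih =>
      intro i
      rw [hrec i, pow_succ', mul_assoc, Finset.sum_mul]
      refine (Finset.abs_sum_le_sum_abs _ _).trans (Finset.sum_le_sum fun j _ => ?_)
      rw [abs_mul]
      exact mul_le_mul_of_nonneg_left (ih _) (abs_nonneg _)
  have h0 : |h i| ≤ 0 := by
    have hlim := (tendsto_pow_atTop_nhds_zero_of_lt_one
      (Finset.sum_nonneg fun j _ => abs_nonneg (θ j)) hs).mul_const C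
    rw [zero_mul] at hlim
    exact ge_of_tendsto' hlim fun n => hpow n i
  exact abs_nonpos_iff.1 h0

/-! ### Cesàro averages and the strong law for lagged products. -/

/-- Splitting a sum according to residues modulo `m`. -/
theorem sum_range_eq_sum_residues {m : ℕ} (hm : 0 < m) (f : ℕ → ℝ) (n : ℕ) :
    ∑ k ∈ Finset.range n, f k =
      ∑ r ∈ Finset.range m, ∑ t ∈ Finset.range ((n + (m - 1 - r)) / m), f (m * t + r) := by
  induction n with
  | zero =>
    refine (Finset.sum_eq_zero fun r hr => ?_).symm
    rw [Nat.div_eq_of_lt (by omega)]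
    simp
  | succ n ih =>
    -- The number `(n + (m - 1 - r)) / m` counts the `k < n` with `k ≡ r` modulo `m`; it increases
    -- at `n` exactly when `n % m = r`.
    have hstep : ∀ r ∈ Finset.range m,
        ∑ t ∈ Finset.range ((n + 1 + (m - 1 - r)) / m), f (m * t + r) =
          ∑ t ∈ Finset.range ((n + (m - 1 - r)) / m), f (m * t + r)
            + if n % m = r then f n else 0 := by
      intro r hr
      have hr' := Finset.mem_range.1 hr
      have hn := Nat.div_add_mod n m
      have hmod := Nat.mod_lt n hm
      split_ifs with h
      · have h1 : (n + 1 + (m - 1 - r)) / m = n / m + 1 := by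
          rw [show n + 1 + (m - 1 - r) = m * (n / m + 1) by rw [mul_add]; omega]
          exact Nat.mul_div_cancel_left _ hm
        have h2 : (n + (m - 1 - r)) / m = n / m := by
          rw [show n + (m - 1 - r) = (m - 1) + m * (n / m) by omega,
            Nat.add_mul_div_left _ _ hm, Nat.div_eq_of_lt (by omega), zero_add]
        rw [h1, h2, Finset.sum_range_succ, ← h, hn]
      · rw [add_zero]
        congr 2
        rcases lt_or_gt_of_ne h with h | h
        · rw [show n + 1 + (m - 1 - r) = (n % m + m - r) + m * (n / m) by omega,
            show n + (m - 1 - r) = (n % m + m - 1 - r) + m * (n / m) by omega,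
            Nat.add_mul_div_left _ _ hm, Nat.add_mul_div_left _ _ hm,
            Nat.div_eq_of_lt (show n % m + m - r < m by omega),
            Nat.div_eq_of_lt (show n % m + m - 1 - r < m by omega)]
        · rw [show n + 1 + (m - 1 - r) = (n % m - r) + m * (n / m + 1) by rw [mul_add]; omega,
            show n + (m - 1 - r) = (n % m - 1 - r) + m * (n / m + 1) by rw [mul_add]; omega,
            Nat.add_mul_div_left _ _ hm, Nat.add_mul_div_left _ _ hm,
            Nat.div_eq_of_lt (show n % m - r < m by omega),
            Nat.div_eq_of_lt (show n % m - 1 - r < m by omega)]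
    rw [Finset.sum_range_succ, ih, Finset.sum_congr rfl hstep, Finset.sum_add_distrib,
      Finset.sum_ite_eq, if_pos (Finset.mem_range.2 (Nat.mod_lt n hm))]

/-- If the averages along all residue classes tend to zero, so do the averages. -/
theorem tendsto_average_of_residues {m : ℕ} (hm : 0 < m) {f : ℕ → ℝ}
    (h : ∀ r < m, Tendsto (fun n : ℕ => (∑ t ∈ Finset.range n, f (m * t + r)) / n) atTop (𝓝 0)) :
    Tendsto (fun n : ℕ => (∑ k ∈ Finset.range n, f k) / n) atTop (𝓝 0) := by
  have hr : ∀ r ∈ Finset.range m, Tendsto (fun n : ℕ =>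
      (∑ t ∈ Finset.range ((n + (m - 1 - r)) / m), f (m * t + r)) / n) atTop (𝓝 0) := by
    intro r hr
    have hdiv : Tendsto (fun n : ℕ => (n + (m - 1 - r)) / m) atTop atTop :=
      (Nat.tendsto_div_const_atTop hm.ne').comp (tendsto_add_atTop_nat _)
    -- The class has at most `n` terms, so dividing by `n` instead of by their number only shrinks
    -- the quotient.
    refine squeeze_zero_norm' ?_ (by simpa using ((h r (Finset.mem_range.1 hr)).comp hdiv).norm)
    filter_upwards [eventually_ge_atTop m] with n hn
    have hc0 : 0 < (n + (m - 1 - r)) / m := Nat.div_pos (by omega) hm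
    have hc : (n + (m - 1 - r)) / m ≤ n := by
      refine Nat.div_le_of_le_mul ?_
      obtain ⟨k, rfl⟩ : ∃ k, m = k + 1 := ⟨m - 1, by omega⟩
      obtain ⟨l, rfl⟩ : ∃ l, n = l + 1 := ⟨n - 1, by omega⟩
      calc l + 1 + (k + 1 - 1 - r) ≤ l + 1 + k := by omega
        _ ≤ (k + 1) * (l + 1) := by nlinarith [Nat.zero_le (k * l)]
    simp only [norm_div, RCLike.norm_natCast, Real.norm_eq_abs]
    have hc' : (((n + (m - 1 - r)) / m : ℕ) : ℝ) ≤ n := by exact_mod_cast hc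
    have hc0' : (0 : ℝ) < ((n + (m - 1 - r)) / m : ℕ) := by exact_mod_cast hc0
    exact div_le_div_of_nonneg_left (abs_nonneg _) hc0' hc'
  have := tendsto_finsetSum (Finset.range m) hr
  simp only [Finset.sum_const_zero] at this
  refine this.congr fun n => ?_
  rw [sum_range_eq_sum_residues hm f n, Finset.sum_div]

/-- The limit of averages ignores finitely many initial terms. -/
theorem tendsto_average_of_add {f g : ℕ → ℝ} {l : ℝ} (m : ℕ) (hfg : ∀ k, f (k + m) = g k)
    (h : Tendsto (fun n : ℕ => (∑ k ∈ Finset.range n, g k) / n) atTop (𝓝 l)) :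
    Tendsto (fun n : ℕ => (∑ k ∈ Finset.range n, f k) / n) atTop (𝓝 l) := by
  induction m generalizing f with
  | zero => simpa [← hfg] using h
  | succ m ih =>
    have h1 := ih (f := fun k => f (k + 1)) fun k => by rw [← hfg k]; congr 1
    rw [← tendsto_add_atTop_iff_nat 1]
    have hratio : Tendsto (fun n : ℕ => (n : ℝ) / (n + 1)) atTop (𝓝 1) :=
      tendsto_natCast_div_add_atTop 1
    have hinv : Tendsto (fun n : ℕ => f 0 * (1 / ((n : ℝ) + 1))) atTop (𝓝 (f 0 * 0)) :=
      tendsto_one_div_add_atTop_nhds_zero_nat.const_mul (f 0)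
    have := (h1.mul hratio).add hinv
    simp only [mul_one, mul_zero, add_zero] at this
    refine this.congr' ?_
    filter_upwards [eventually_gt_atTop 0] with n hn
    have : (0 : ℝ) < n := by exact_mod_cast hn
    rw [Finset.sum_range_succ']
    push_cast
    field_simp

section StrongLaw

variable {Ω : Type*} [MeasurableSpace Ω] {μ : Measure Ω} {W : ℕ → Ω → ℝ}

theorem ae_tendsto_average_sq (hL2 : MemLp (W 0) 2 μ) (hindep : iIndepFun W μ)
    (hident : ∀ k, IdentDistrib (W k) (W 0) μ μ) :
    ∀ᵐ ω ∂μ, Tendsto (fun n : ℕ => (∑ k ∈ Finset.range n, W k ω * W k ω) / n) atTop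
      (𝓝 (∫ ω, W 0 ω * W 0 ω ∂μ)) := by
  have hmeas : Measurable fun x : ℝ => x * x := by fun_prop
  exact strong_law_ae_real (fun k ω => W k ω * W k ω) (hL2.integrable_mul hL2)
    (fun i j hij => (hindep.indepFun hij).comp hmeas hmeas) (fun k => (hident k).comp hmeas)

/-- Overlapping products `W (k + j) * W k` need not be independent. Within a residue class modulo `j
+ 1` the index pairs are disjoint, so the products are pairwise independent and the strong law
applies to each class. -/
theorem ae_tendsto_average_mul [IsProbabilityMeasure μ] (hL2 : MemLp (W 0) 2 μ) (hindep : iIndepFun W μ)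
    (hident : ∀ k, IdentDistrib (W k) (W 0) μ μ) (hmean : ∫ ω, W 0 ω ∂μ = 0) {j : ℕ}
    (hj : 0 < j) :
    ∀ᵐ ω ∂μ, Tendsto (fun n : ℕ => (∑ k ∈ Finset.range n, W (k + j) ω * W k ω) / n) atTop
      (𝓝 0) := by
  have hint (k : ℕ) : Integrable (W k) μ :=
    (hident k).integrable_iff.2 (hL2.integrable one_le_two)
  have hpair (k : ℕ) : IndepFun (W (k + j)) (W k) μ := hindep.indepFun (by omega)
  have hres : ∀ r : ℕ, ∀ᵐ ω ∂μ, Tendsto (fun n : ℕ => (∑ t ∈ Finset.range n,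
      W ((j + 1) * t + r + j) ω * W ((j + 1) * t + r) ω) / n) atTop (𝓝 0) := by
    intro r
    have hzero : ∫ ω, W ((j + 1) * 0 + r + j) ω * W ((j + 1) * 0 + r) ω ∂μ = 0 := by
      refine ((hpair ((j + 1) * 0 + r)).integral_mul_eq_mul_integral
        (hint _).aestronglyMeasurable (hint _).aestronglyMeasurable).trans ?_
      rw [(hident ((j + 1) * 0 + r)).integral_eq, hmean]
      exact mul_zero _
    rw [← hzero]
    refine strong_law_ae_real
      (fun t ω => W ((j + 1) * t + r + j) ω * W ((j + 1) * t + r) ω)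
      ((hpair _).integrable_mul (hint _) (hint _)) (fun s t hst => ?_) (fun t => ?_)
    · have hgap : (j + 1) * s + j < (j + 1) * t ∨ (j + 1) * t + j < (j + 1) * s := by
        rcases lt_or_gt_of_ne hst with h | h
        · left; nlinarith
        · right; nlinarith
      exact hindep.indepFun_mul_mul₀ (fun i => (hident i).aemeasurable_fst) _ _ _ _
        (by omega) (by omega) (by omega) (by omega)
    · exact (IdentDistrib.prodMk ((hident _).trans (hident _).symm)
        ((hident _).trans (hident _).symm) (hpair _) (hpair _)).comp measurable_mul
  filter_upwards [ae_all_iff.2 hres] with ω hω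
  exact tendsto_average_of_residues (m := j + 1) (f := fun k => W (k + j) ω * W k ω)
    j.succ_pos fun r _ => hω r

end StrongLaw

/-! ### Orthogonality of the past to the innovations. -/

section Recursion

variable {U : Ultrafilter ℕ} {p : ℕ} {θ : Fin p → ℝ} {y d w : ℤ → ℝ}

theorem ip_shift_eq_of_recursion (hy : IsTame y) (hd : IsTame d)
    (hrec : ∀ m, y m = ∑ i, θ i * shift ((i : ℕ) + 1) y m + d m) (hw : IsTame w) (j : ℕ) :
    ip U (shift j y) w =
      ∑ i, θ i * ip U (shift (j + ((i : ℕ) + 1)) y) w + ip U (shift j d) w := by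
  refine ip_combination (fun m => ?_) (fun i => hy.comp_shift _) (hd.comp_shift j) hw
  simp only [← shift_shift j]
  exact hrec _

/-- Past values of a stable autoregression are uncorrelated with `w` if those of its driving
sequence are. -/
theorem ip_shift_eq_zero_of_recursion (hU : (U : Filter ℕ) ≤ atTop) (hs : ∑ i, |θ i| < 1)
    (hy : IsTame y) (hd : IsTame d)
    (hrec : ∀ m, y m = ∑ i, θ i * shift ((i : ℕ) + 1) y m + d m) (hw : IsTame w)
    (hdw : ∀ j, ip U (shift (j + 1) d) w = 0) (j : ℕ) : ip U (shift (j + 1) y) w = 0 := by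
  -- Read as a function of the lag, the correlation solves the recursion forwards; shift invariance
  -- bounds it uniformly in the lag.
  refine eq_zero_of_forward_recursion (h := fun j => ip U (shift (j + 1) y) w)
    (C := ip U y y + ip U w w) hs (fun i => ?_) (fun i => ?_) j
  · rw [← ip_shift hU hy hy (i + 1)]
    exact abs_ip_le (hy.comp_shift _) hw
  · rw [ip_shift_eq_of_recursion hy hd hrec hw, hdw, add_zero]
    refine Finset.sum_congr rfl fun k _ => ?_
    rw [add_right_comm]

theorem ip_eq_of_recursion (hU : (U : Filter ℕ) ≤ atTop) (hs : ∑ i, |θ i| < 1)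
    (hy : IsTame y) (hd : IsTame d)
    (hrec : ∀ m, y m = ∑ i, θ i * shift ((i : ℕ) + 1) y m + d m) (hw : IsTame w)
    (hdw : ∀ j, ip U (shift (j + 1) d) w = 0) : ip U y w = ip U d w := by
  have h := ip_shift_eq_of_recursion (U := U) hy hd hrec hw 0
  simp only [shift_zero, zero_add, ip_shift_eq_zero_of_recursion hU hs hy hd hrec hw hdw,
    mul_zero, Finset.sum_const_zero] at h
  exact h

end Recursion

/-- An autoregression `x` driven by the autoregressive noise `e` of a tame sequence `u` whose
empirical autocovariances along `U` are those of a white noise. -/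
structure IsLimitModel (U : Ultrafilter ℕ) {p : ℕ} (θ : Fin p → ℝ) (ρ : ℝ) (x e u : ℤ → ℝ) :
    Prop where
  le_atTop : (U : Filter ℕ) ≤ atTop
  sum_abs_lt : ∑ i, |θ i| < 1
  abs_lt : |ρ| < 1
  tame_x : IsTame x
  tame_e : IsTame e
  tame_u : IsTame u
  process : ∀ m, x m = ∑ i, θ i * shift ((i : ℕ) + 1) x m + e m
  -- The sum over `Fin 1` casts the AR(1) noise as an autoregression of order one, so the same
  -- lemmas serve `x` and `e`.
  noise : ∀ m, e m = ∑ i : Fin 1, ρ * shift ((i : ℕ) + 1) e m + u m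
  white : ∀ j, ip U (shift (j + 1) u) u = 0
  white_pos : 0 < ip U u u

namespace IsLimitModel

variable {U : Ultrafilter ℕ} {p : ℕ} {θ : Fin p → ℝ} {ρ : ℝ} {x e u : ℤ → ℝ}

theorem ip_shift_noise (h : IsLimitModel U θ ρ x e u) (j : ℕ) : ip U (shift (j + 1) e) u = 0 :=
  ip_shift_eq_zero_of_recursion (θ := fun _ : Fin 1 => ρ) h.le_atTop (by simpa using h.abs_lt)
    h.tame_e h.tame_u h.noise h.tame_u h.white j

theorem ip_shift_process (h : IsLimitModel U θ ρ x e u) (j : ℕ) :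
    ip U (shift (j + 1) x) u = 0 :=
  ip_shift_eq_zero_of_recursion h.le_atTop h.sum_abs_lt h.tame_x h.tame_e h.process h.tame_u
    h.ip_shift_noise j

/-- Lagged terms are orthogonal to `u`, so `x`, `e` and `u` all have the same correlation with `u`.
-/
theorem ip_process (h : IsLimitModel U θ ρ x e u) : ip U x u = ip U u u :=
  (ip_eq_of_recursion h.le_atTop h.sum_abs_lt h.tame_x h.tame_e h.process h.tame_u
    h.ip_shift_noise).trans
    (ip_eq_of_recursion (θ := fun _ : Fin 1 => ρ) h.le_atTop (by simpa using h.abs_lt)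
      h.tame_e h.tame_u h.noise h.tame_u h.white)

end IsLimitModel

/-! ### The limiting Gram matrix and the Yule–Walker equations. -/

/-- The limiting normalized Gram matrix. -/
noncomputable def limitGram (U : Ultrafilter ℕ) (p : ℕ) (x : ℤ → ℝ) :
    Matrix (Fin p) (Fin p) ℝ :=
  Matrix.of fun i j => ip U (shift i x) (shift j x)

/-- The limiting vector of autocovariances at lags `1, …, p`. -/
noncomputable def limitCov (U : Ultrafilter ℕ) (p : ℕ) (x : ℤ → ℝ) : Fin p → ℝ :=
  fun i => ip U x (shift ((i : ℕ) + 1) x)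

theorem IsTame.zero : IsTame (fun _ => 0) :=
  ⟨fun _ _ => rfl, ⟨0, by simp⟩, fun δ hδ => ⟨0, fun n => by simp; positivity⟩⟩

theorem ip_zero (U : Ultrafilter ℕ) (b : ℤ → ℝ) : ip U (fun _ => 0) b = 0 :=
  ip_eq_of_tendsto (by simp)

theorem IsTame.add {a b : ℤ → ℝ} (ha : IsTame a) (hb : IsTame b) :
    IsTame fun m => a m + b m := by
  have hsq (x y : ℝ) : (x + y) ^ 2 ≤ 2 * (x ^ 2 + y ^ 2) := by nlinarith [sq_nonneg (x - y)]
  refine ⟨fun m hm => by simp [ha.zero_neg m hm, hb.zero_neg m hm], ?_, fun δ hδ => ?_⟩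
  · obtain ⟨A, hA⟩ := ha.sum_sq_le
    obtain ⟨B, hB⟩ := hb.sum_sq_le
    refine ⟨2 * (A + B), fun n => (Finset.sum_le_sum fun (k : ℕ) _ => hsq (a k) (b k)).trans ?_⟩
    rw [← Finset.mul_sum, Finset.sum_add_distrib]
    linarith [hA n, hB n]
  · obtain ⟨A, hA⟩ := ha.sq_le (δ / 4) (by positivity)
    obtain ⟨B, hB⟩ := hb.sq_le (δ / 4) (by positivity)
    exact ⟨2 * (A + B), fun n => by linarith [hA n, hB n, hsq (a n) (b n)]⟩

theorem IsTame.const_mul {a : ℤ → ℝ} (ha : IsTame a) (c : ℝ) : IsTame fun m => c * a m := by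
  refine ⟨fun m hm => by simp [ha.zero_neg m hm], ?_, fun δ hδ => ?_⟩
  · obtain ⟨A, hA⟩ := ha.sum_sq_le
    refine ⟨c ^ 2 * A, fun n => ?_⟩
    simp only [mul_pow]
    rw [← Finset.mul_sum, mul_assoc]
    exact mul_le_mul_of_nonneg_left (hA n) (sq_nonneg c)
  · obtain ⟨A, hA⟩ := ha.sq_le (δ / (c ^ 2 + 1)) (by positivity)
    refine ⟨c ^ 2 * A, fun n => ?_⟩
    have h1 : c ^ 2 * (δ / (c ^ 2 + 1)) ≤ δ := by
      rw [← mul_div_assoc, div_le_iff₀ (by positivity)]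
      nlinarith
    rw [mul_pow]
    nlinarith [mul_le_mul_of_nonneg_left (hA n) (sq_nonneg c),
      mul_le_mul_of_nonneg_right h1 (Nat.cast_nonneg n : (0 : ℝ) ≤ n)]

theorem IsTame.sum {ι : Type*} (s : Finset ι) {f : ι → ℤ → ℝ} (hf : ∀ i, IsTame (f i)) :
    IsTame fun m => ∑ i ∈ s, f i m := by
  classical
  induction s using Finset.induction_on with
  | empty => simpa using IsTame.zero
  | insert i s hi ih => simpa only [Finset.sum_insert hi] using (hf i).add ih

theorem ip_sum {U : Ultrafilter ℕ} {ι : Type*} [Fintype ι] (c : ι → ℝ) {f : ι → ℤ → ℝ}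
    (hf : ∀ i, IsTame (f i)) {b : ℤ → ℝ} (hb : IsTame b) :
    ip U (fun m => ∑ i, c i * f i m) b = ∑ i, c i * ip U (f i) b := by
  have := ip_combination (U := U) (a := fun m => ∑ i, c i * f i m) (fun m => (add_zero _).symm)
    hf IsTame.zero hb
  rwa [ip_zero, add_zero] at this

theorem limitGram_mulVec {U : Ultrafilter ℕ} {p : ℕ} {x : ℤ → ℝ} (hx : IsTame x)
    (c : Fin p → ℝ) (i : Fin p) :
    (limitGram U p x).mulVec c i = ip U (fun m => ∑ j, c j * shift j x m) (shift i x) := by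
  rw [ip_sum c (fun j => hx.comp_shift _) (hx.comp_shift _)]
  simp only [Matrix.mulVec, dotProduct, limitGram, Matrix.of_apply]
  exact Finset.sum_congr rfl fun j _ => by rw [ip_comm, mul_comm]

/-- A kernel vector `c` gives a combination `z` of lags of `x` with `ip U z z = 0`. By
Cauchy–Schwarz `z` is orthogonal to every delayed innovation, which forces the coordinates of `c` to
vanish one after another. -/
theorem IsLimitModel.isUnit_det_limitGram {U : Ultrafilter ℕ} {p : ℕ} {θ : Fin p → ℝ} {ρ : ℝ}
    {x e u : ℤ → ℝ} (h : IsLimitModel U θ ρ x e u) : IsUnit (limitGram U p x).det := by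
  rw [isUnit_iff_ne_zero]
  intro hdet
  obtain ⟨c, hc, hmul⟩ := Matrix.exists_mulVec_eq_zero_iff.2 hdet
  set z : ℤ → ℝ := fun m => ∑ j, c j * shift j x m with hz
  have hztame : IsTame z := IsTame.sum _ fun j => (h.tame_x.comp_shift _).const_mul _
  have hzz : ip U z z = 0 := by
    rw [hz, ip_sum c (fun j => h.tame_x.comp_shift _) hztame]
    refine Finset.sum_eq_zero fun j _ => ?_
    rw [ip_comm, ← limitGram_mulVec h.tame_x c j, hmul, Pi.zero_apply, mul_zero]
  refine hc (funext fun j => ?_)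
  -- Against `shift j u`, lags below `j` have zero coefficient by induction and lags above `j` lie
  -- in the past of the innovation; only `c j * ip U u u` survives.
  induction j using WellFoundedLT.induction with
  | _ j ih =>
    have h1 : ip U z (shift j u) = c j * ip U u u := by
      rw [hz, ip_sum c (fun j => h.tame_x.comp_shift _) (h.tame_u.comp_shift _),
        Finset.sum_eq_single j]
      · rw [ip_shift h.le_atTop h.tame_x h.tame_u, h.ip_process]
      · intro k _ hk
        rcases lt_or_gt_of_ne hk with hlt | hgt
        · rw [ih k hlt, Pi.zero_apply, zero_mul]
        · obtain ⟨l, hl⟩ : ∃ l, (k : ℕ) = l + 1 + j := ⟨k - j - 1, by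
            have : (j : ℕ) < k := hgt
            omega⟩
          have := ip_shift_add h.le_atTop h.tame_x h.tame_u (l + 1) 0 j
          rw [zero_add, shift_zero, h.ip_shift_process] at this
          rw [hl, this, mul_zero]
      · simp
    have h2 := ip_sq_le (U := U) hztame (h.tame_u.comp_shift j)
    rw [hzz, zero_mul, h1] at h2
    have h3 : c j * ip U u u = 0 := pow_eq_zero_iff two_ne_zero |>.1 (le_antisymm h2 (sq_nonneg _))
    exact (mul_eq_zero.1 h3).resolve_right h.white_pos.ne'

/-- This is the elimination of the noise: substituting `ε_{n-1} = X_{n-1} - ∑ θ_i X_{n-1-i}` into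
the equation for `X_n` yields an AR(`p + 1`) recursion. Here `c k` stands for the term at lag `k`.
-/
theorem sum_beta_mul {p : ℕ} [NeZero p] (θ : Fin p → ℝ) (ρ : ℝ) (c : ℕ → ℝ) :
    ∑ i, θ i * c (i + 1) + ρ * (c 1 - ∑ i, θ i * c (i + 2)) =
      ∑ i, beta θ ρ i * c (i + 1) - lastCoeff θ * ρ * c (p + 1) := by
  obtain ⟨q, rfl⟩ : ∃ q, p = q + 1 := ⟨p - 1, by have := NeZero.ne p; omega⟩
  have hb0 : beta θ ρ 0 = θ 0 + ρ := by simp [beta]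
  have hbs (i : Fin q) : beta θ ρ i.succ = θ i.succ - θ i.castSucc * ρ := by
    simp [beta]; left; rfl
  have hl : lastCoeff θ = θ (Fin.last q) := rfl
  rw [Fin.sum_univ_succ (fun i => beta θ ρ i * c (i + 1)), hb0, hl,
    Fin.sum_univ_castSucc (fun i => θ i * c (i + 2)), Fin.sum_univ_succ (fun i => θ i * c (i + 1))]
  simp only [hbs, sub_mul, Finset.sum_sub_distrib, Fin.val_castSucc, Fin.val_succ, Fin.val_last,
    Fin.val_zero]
  have : ∑ i : Fin q, θ i.castSucc * ρ * c (i + 1 + 1) =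
      ρ * ∑ i : Fin q, θ i.castSucc * c (i + 2) := by
    rw [Finset.mul_sum]
    exact Finset.sum_congr rfl fun i _ => by ring
  rw [this]
  ring

/-- The Yule–Walker equations of the AR(`p + 1`) representation. -/
theorem IsLimitModel.limitGram_mulVec_beta {U : Ultrafilter ℕ} {p : ℕ} [NeZero p]
    {θ : Fin p → ℝ} {ρ : ℝ} {x e u : ℤ → ℝ} (h : IsLimitModel U θ ρ x e u) (i : Fin p) :
    (limitGram U p x).mulVec (beta θ ρ) i =
      limitCov U p x i + lastCoeff θ * ρ * limitCov U p x i.rev := by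
  set y := shift ((i : ℕ) + 1) x with hy
  have hyt : IsTame y := h.tame_x.comp_shift _
  have e0 := ip_shift_eq_of_recursion (U := U) h.tame_x h.tame_e h.process hyt 0
  have e1 := ip_shift_eq_of_recursion (U := U) h.tame_x h.tame_e h.process hyt 1
  have e2 := ip_shift_eq_of_recursion (U := U) (θ := fun _ : Fin 1 => ρ) h.tame_e h.tame_u h.noise
    hyt 0
  have huy : ip U u y = 0 := by rw [ip_comm]; exact h.ip_shift_process i
  simp only [shift_zero, zero_add, Finset.univ_unique, Finset.sum_singleton, huy, add_zero,
    Fin.default_eq_zero, Fin.val_zero] at e0 e1 e2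
  have key := sum_beta_mul θ ρ fun k => ip U (shift k x) y
  have e1' : ∑ k : Fin p, θ k * ip U (shift ((k : ℕ) + 2) x) y =
      ∑ k : Fin p, θ k * ip U (shift (1 + ((k : ℕ) + 1)) x) y :=
    Finset.sum_congr rfl fun k _ => by rw [add_comm 1, add_assoc]
  have hcov : limitCov U p x i = ip U x y := rfl
  -- The extra lag `p + 1` against lag `i + 1` leaves a gap of `p - i`, the lag stored at index
  -- `i.rev`.
  have hrev : ip U (shift (p + 1) x) y = limitCov U p x i.rev := by
    have := ip_shift_add (U := U) h.le_atTop h.tame_x h.tame_x (p - i) 0 (i + 1)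
    rw [zero_add, shift_zero] at this
    rw [limitCov, ip_comm x, Fin.val_rev, show p - ((i : ℕ) + 1) + 1 = p - i by omega, ← this, hy]
    congr 2
    omega
  have hgram : ∑ k, beta θ ρ k * ip U (shift ((k : ℕ) + 1) x) y =
      (limitGram U p x).mulVec (beta θ ρ) i := by
    simp only [Matrix.mulVec, dotProduct, limitGram, Matrix.of_apply]
    refine Finset.sum_congr rfl fun k _ => ?_
    rw [hy, ip_shift_add h.le_atTop h.tame_x h.tame_x, ip_comm, mul_comm]
  rw [hcov, ← hrev, ← hgram]
  rw [e1'] at key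
  have hρ : ip U e y = ρ * (ip U (shift 1 x) y
      - ∑ k : Fin p, θ k * ip U (shift (1 + ((k : ℕ) + 1)) x) y) := by
    rw [e2, e1]; ring
  rw [hρ] at e0
  linarith

theorem exchangeMatrix_mulVec {p : ℕ} (c : Fin p → ℝ) (i : Fin p) :
    (exchangeMatrix p).mulVec c i = c i.rev := by
  simp only [Matrix.mulVec, dotProduct, exchangeMatrix, Matrix.of_apply]
  rw [Finset.sum_eq_single i.rev]
  · rw [if_pos (by rw [Fin.val_rev]; omega), one_mul]
  · intro j _ hj
    rw [if_neg, zero_mul]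
    intro hij
    exact hj (Fin.ext (by rw [Fin.val_rev]; omega))
  · simp

/-- By shift invariance and symmetry the entries depend only on `|i - j|`, so the matrix commutes
with index reversal. -/
theorem limitGram_mulVec_rev {U : Ultrafilter ℕ} (hU : (U : Filter ℕ) ≤ atTop) {p : ℕ}
    {x : ℤ → ℝ} (hx : IsTame x) (c : Fin p → ℝ) (i : Fin p) :
    (limitGram U p x).mulVec (fun j => c j.rev) i = (limitGram U p x).mulVec c i.rev := by
  simp only [Matrix.mulVec, dotProduct, limitGram, Matrix.of_apply]
  rw [← Equiv.sum_comp Fin.revPerm]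
  refine Finset.sum_congr rfl fun j _ => ?_
  simp only [Fin.revPerm_apply, Fin.rev_rev, Fin.val_rev]
  congr 1
  have hlag (a b k : ℕ) (h : b = a + k) : ip U (shift a x) (shift b x) = ip U x (shift k x) := by
    simpa [h, add_comm] using ip_shift_add hU hx hx 0 k a
  rcases le_total ((i : ℕ) + j + 1) p with hle | hle
  · obtain ⟨k, hk⟩ := Nat.exists_eq_add_of_le hle
    rw [hlag i _ k (by omega), ip_comm (shift (p - ((i : ℕ) + 1)) x), hlag j _ k (by omega)]
  · obtain ⟨k, hk⟩ := Nat.exists_eq_add_of_le hle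
    rw [ip_comm, hlag _ i k (by omega), hlag _ j k (by omega)]

theorem abs_lastCoeff_mul_lt {p : ℕ} [NeZero p] {θ : Fin p → ℝ} {ρ : ℝ} (hθ : ∑ i, |θ i| < 1)
    (hρ : |ρ| < 1) : |lastCoeff θ * ρ| < 1 := by
  have h1 : |lastCoeff θ| < 1 :=
    (Finset.single_le_sum (f := fun i => |θ i|) (fun i _ => abs_nonneg _)
      (Finset.mem_univ _)).trans_lt hθ
  rw [abs_mul]
  nlinarith [abs_nonneg (lastCoeff θ), abs_nonneg ρ]

/-- With `J ^ 2 = I` and `Γ J = J Γ`, one gets `Γ (I - τ J) β = (I - τ J) (I + τ J) γ = (1 - τ ^ 2)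
γ`, and `α = 1 / (1 - τ ^ 2)`. -/
theorem IsLimitModel.limitGram_mulVec_thetaStar {U : Ultrafilter ℕ} {p : ℕ} [NeZero p]
    {θ : Fin p → ℝ} {ρ : ℝ} {x e u : ℤ → ℝ} (h : IsLimitModel U θ ρ x e u) :
    (limitGram U p x).mulVec (thetaStar θ ρ) = limitCov U p x := by
  obtain ⟨hτ, hτ'⟩ := _root_.abs_lt.1 (abs_lastCoeff_mul_lt h.sum_abs_lt h.abs_lt)
  have hstar : thetaStar θ ρ = alpha θ ρ •
      (beta θ ρ - (lastCoeff θ * ρ) • fun j => beta θ ρ (Fin.rev j)) := by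
    rw [thetaStar, Matrix.sub_mulVec, Matrix.one_mulVec, Matrix.smul_mulVec]
    congr 3
    exact funext (exchangeMatrix_mulVec _)
  ext i
  rw [hstar, Matrix.mulVec_smul, Matrix.mulVec_sub, Matrix.mulVec_smul]
  simp only [Pi.smul_apply, Pi.sub_apply, smul_eq_mul]
  rw [limitGram_mulVec_rev h.le_atTop h.tame_x, h.limitGram_mulVec_beta, h.limitGram_mulVec_beta,
    Fin.rev_rev, alpha]
  have h1 : 1 - lastCoeff θ * ρ ≠ 0 := by linarith
  have h2 : 1 + lastCoeff θ * ρ ≠ 0 := by linarith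
  field_simp
  ring

/-! ### From innovations along a path to convergence of the estimator. -/

/-- A sequence whose squares have convergent averages is tame. -/
theorem IsTame.of_tendsto {u : ℤ → ℝ} {l : ℝ} (hneg : ∀ m < 0, u m = 0)
    (h : Tendsto (fun n : ℕ => (∑ k ∈ Finset.range n, u k * u k) / n) atTop (𝓝 l)) :
    IsTame u := by
  simp only [← sq] at h
  refine ⟨hneg, ?_, fun δ hδ => ?_⟩
  · obtain ⟨C, hC⟩ := h.bddAbove_range
    refine ⟨C, fun n => ?_⟩
    rcases n.eq_zero_or_pos with rfl | hn
    · simp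
    · exact (div_le_iff₀ (by exact_mod_cast hn)).1 (hC ⟨n, rfl⟩)
  · have hmono : Monotone fun n => ∑ k ∈ Finset.range n, u k ^ 2 := fun a b hab =>
      Finset.sum_le_sum_of_subset_of_nonneg (Finset.range_mono hab) fun _ _ _ => sq_nonneg _
    obtain ⟨N, hN⟩ := Metric.tendsto_atTop.1 h (δ / 2) (by positivity)
    refine ⟨|l| + δ + ∑ k ∈ Finset.range (N + 1), u k ^ 2, fun n => ?_⟩
    have hS : 0 ≤ ∑ k ∈ Finset.range (N + 1), u k ^ 2 :=
      Finset.sum_nonneg fun _ _ => sq_nonneg _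
    have hl := le_abs_self l
    have hn0 : (0 : ℝ) ≤ n := Nat.cast_nonneg n
    rcases le_or_gt n N with hn | hn
    · have h1 : u n ^ 2 ≤ ∑ k ∈ Finset.range (N + 1), u k ^ 2 :=
        Finset.single_le_sum (f := fun k : ℕ => u k ^ 2) (fun _ _ => sq_nonneg _)
          (Finset.mem_range.2 (by omega))
      nlinarith [abs_nonneg l]
    -- The square `u n ^ 2` is a difference of consecutive partial sums, hence below `(l + δ/2) (n +
    -- 1) - (l - δ/2) n = δ n + l + δ/2`.
    · have hn' : (0 : ℝ) < n := by exact_mod_cast (by omega : 0 < n)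
      have h1 := (abs_lt.1 (hN n (by omega))).1
      have h2 := (abs_lt.1 (hN (n + 1) (by omega))).2
      rw [lt_sub_iff_add_lt, lt_div_iff₀ hn'] at h1
      rw [sub_lt_iff_lt_add, Nat.cast_add, Nat.cast_one, div_lt_iff₀ (by linarith),
        Finset.sum_range_succ] at h2
      nlinarith

/-- Continuity of the solution of a linear system, with normalization. -/
theorem tendsto_inv_mulVec {ι : Type*} {F : Filter ι} {p : ℕ}
    {A : ι → Matrix (Fin p) (Fin p) ℝ} {b : ι → Fin p → ℝ} {c : ι → ℝ}
    {G : Matrix (Fin p) (Fin p) ℝ} {g t : Fin p → ℝ} (hc : ∀ᶠ n in F, c n ≠ 0)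
    (hA : Tendsto (fun n => c n • A n) F (𝓝 G)) (hb : Tendsto (fun n => c n • b n) F (𝓝 g))
    (hG : IsUnit G.det) (ht : G.mulVec t = g) :
    Tendsto (fun n => (A n)⁻¹.mulVec (b n)) F (𝓝 t) := by
  -- The inverse is handled as adjugate over determinant, both continuous; the normalization `c n`
  -- cancels, and `A n` is invertible eventually because `G` is.
  have hcdet : Continuous fun M : Matrix (Fin p) (Fin p) ℝ => M.det := continuous_id.matrix_det
  have hcadj : Continuous fun q : Matrix (Fin p) (Fin p) ℝ × (Fin p → ℝ) =>
      q.1.adjugate.mulVec q.2 := continuous_fst.matrix_adjugate.matrix_mulVec continuous_snd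
  have hdet := (hcdet.tendsto G).comp hA
  have hadj := (hcadj.tendsto (G, g)).comp (hA.prodMk_nhds hb)
  simp only [Function.comp_def] at hdet hadj
  have hlim := (hdet.inv₀ hG.ne_zero).smul hadj
  have hval : G.det⁻¹ • G.adjugate.mulVec g = t := by
    rw [← ht, Matrix.mulVec_mulVec, Matrix.adjugate_mul, Matrix.smul_mulVec, Matrix.one_mulVec,
      smul_smul, inv_mul_cancel₀ hG.ne_zero, one_smul]
  rw [hval] at hlim
  refine hlim.congr' ?_
  filter_upwards [hc, hdet.eventually_ne hG.ne_zero] with n hn hd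
  have hAn : A n = (c n)⁻¹ • (c n • A n) := by rw [smul_smul, inv_mul_cancel₀ hn, one_smul]
  have hinv : (A n)⁻¹ = c n • (c n • A n)⁻¹ := by
    have : Invertible (c n)⁻¹ := invertibleOfNonzero (inv_ne_zero hn)
    conv_lhs => rw [hAn]
    rw [Matrix.inv_smul _ _ (isUnit_iff_ne_zero.2 hd), invOf_eq_inv, inv_inv]
  rw [hinv, Matrix.inv_def, Ring.inverse_eq_inv']
  simp only [Matrix.smul_mulVec, Matrix.mulVec_smul]
  exact smul_comm _ _ _

/-- The trajectory, put to zero at negative times. -/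
def cutoff (x : ℤ → ℝ) : ℤ → ℝ := fun m => if m < 0 then 0 else x m

theorem cutoff_of_neg (x : ℤ → ℝ) {m : ℤ} (h : m < 0) : cutoff x m = 0 := if_pos h

theorem cutoff_of_nonneg (x : ℤ → ℝ) {m : ℤ} (h : 0 ≤ m) : cutoff x m = x m :=
  if_neg (not_lt.2 h)

/-- Lag vectors and recursions only look back to time `-p`, so the arbitrary values before it can be
replaced by the zeros that tameness requires. -/
theorem IsTrajectory.cutoff_eq {p : ℕ} {θ : Fin p → ℝ} {ρ : ℝ} {x : ℤ → ℝ} {ε v : ℕ → ℝ}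
    (h : IsTrajectory θ ρ x ε v) {m : ℤ} (hm : -(p : ℤ) ≤ m) : x m = cutoff x m := by
  rcases lt_or_ge m 0 with h0 | h0
  · rw [cutoff_of_neg x h0, h.init_neg m hm h0]
  · rw [cutoff_of_nonneg x h0]

theorem sum_Icc_one_eq_sum_range {M : Type*} [AddCommMonoid M] (f : ℕ → M) (n : ℕ) :
    ∑ k ∈ Finset.Icc 1 n, f k = ∑ k ∈ Finset.range n, f (k + 1) := by
  induction n with
  | zero => simp
  | succ n ih => rw [Finset.sum_Icc_succ_top (by omega), ih, Finset.sum_range_succ]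

section Trajectory

variable {p : ℕ} {θ : Fin p → ℝ} {ρ : ℝ} {x : ℤ → ℝ} {ε v : ℕ → ℝ} {U : Ultrafilter ℕ}

theorem IsTrajectory.tendsto_gramMatrix (h : IsTrajectory θ ρ x ε v)
    (hU : (U : Filter ℕ) ≤ atTop) (hx : IsTame (cutoff x)) (S : Matrix (Fin p) (Fin p) ℝ) :
    Tendsto (fun n : ℕ => (n : ℝ)⁻¹ • gramMatrix S x (n - 1)) U
      (𝓝 (limitGram U p (cutoff x))) := by
  refine tendsto_pi_nhds.2 fun i => tendsto_pi_nhds.2 fun j => ?_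
  have h1 := (tendsto_ip (U := U) (hx.comp_shift i) (hx.comp_shift j)).add
    ((tendsto_const_div_atTop_nhds_zero_nat (S i j)).mono_left hU)
  rw [add_zero] at h1
  refine h1.congr' ?_
  filter_upwards [hU (eventually_ge_atTop 1)] with n hn
  rw [Matrix.smul_apply, gramMatrix, Nat.sub_add_cancel hn, Matrix.add_apply, Matrix.sum_apply,
    smul_eq_mul, ← add_div, div_eq_inv_mul]
  congr 2
  refine Finset.sum_congr rfl fun k _ => ?_
  rw [Matrix.vecMulVec_apply, lagVector, lagVector, h.cutoff_eq (by omega),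
    h.cutoff_eq (by omega)]
  rfl

theorem IsTrajectory.tendsto_sum_smul_lagVector (h : IsTrajectory θ ρ x ε v)
    (hU : (U : Filter ℕ) ≤ atTop) (hx : IsTame (cutoff x)) :
    Tendsto (fun n : ℕ => (n : ℝ)⁻¹ •
      ∑ k ∈ Finset.Icc 1 n, x (k : ℤ) • lagVector p x ((k : ℤ) - 1)) U
      (𝓝 (limitCov U p (cutoff x))) := by
  refine tendsto_pi_nhds.2 fun i => ?_
  refine (tendsto_ip_succ hU hx (hx.comp_shift (i + 1))).congr fun n => ?_
  rw [Pi.smul_apply, Finset.sum_apply, sum_Icc_one_eq_sum_range, Finset.sum_range_succ',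
    smul_eq_mul, div_eq_inv_mul]
  simp only [shift]
  rw [cutoff_of_neg x (m := ((0 : ℕ) : ℤ) - ((i : ℕ) + 1 : ℕ))
      (by omega), mul_zero, add_zero]
  congr 1
  refine Finset.sum_congr rfl fun k _ => ?_
  rw [Pi.smul_apply, smul_eq_mul, lagVector, h.cutoff_eq (m := ((k + 1 : ℕ) : ℤ)) (by omega),
    h.cutoff_eq (by omega)]
  congr 2
  push_cast
  ring

/-- Strong consistency along a trajectory whose innovations have the empirical autocovariances
of a white noise. -/
theorem IsTrajectory.tendsto_lsEstimator [NeZero p] (h : IsTrajectory θ ρ x ε v)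
    (hθ : ∑ i, |θ i| < 1) (hρ : |ρ| < 1) {s : ℝ} (hs : 0 < s)
    (hsq : Tendsto (fun n : ℕ => (∑ k ∈ Finset.range n, v (k + 1) * v (k + 1)) / n) atTop (𝓝 s))
    (hcov : ∀ j : ℕ, Tendsto (fun n : ℕ =>
      (∑ k ∈ Finset.range n, v (k + (j + 1) + 1) * v (k + 1)) / n) atTop (𝓝 0))
    (S : Matrix (Fin p) (Fin p) ℝ) :
    Tendsto (fun n : ℕ => lsEstimator S x n) atTop (𝓝 (thetaStar θ ρ)) := by
  set e : ℤ → ℝ := fun m => if m < 0 then 0 else ε m.toNat with he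
  -- Treating `ε 0` as the innovation at time `0` makes both recursions hold at every integer time.
  set u : ℤ → ℝ := fun m => if m < 0 then 0 else if m = 0 then ε 0 else v m.toNat with hu
  have huv (n : ℕ) : u ((n + 1 : ℕ) : ℤ) = v (n + 1) := by
    simp only [hu]
    rw [if_neg (by omega), if_neg (by omega), Int.toNat_natCast]
  have husq : Tendsto (fun n : ℕ => (∑ k ∈ Finset.range n, u k * u k) / n) atTop (𝓝 s) :=
    tendsto_average_of_add (f := fun k => u k * u k) 1 (fun k => by rw [huv]) hsq
  have hucov (j : ℕ) : Tendsto (fun n : ℕ => (∑ k ∈ Finset.range n, shift (j + 1) u k * u k) / n)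
      atTop (𝓝 0) := by
    -- Dropping `j + 2` terms makes both factors start at time at least `1`, past the initial value
    -- `ε 0`.
    refine tendsto_average_of_add (f := fun k => shift (j + 1) u k * u k) (j + 1 + 1)
      (fun k => ?_) (hcov j)
    rw [← huv, ← huv, mul_comm]
    congr 1
    rw [shift]
    congr 1
    push_cast
    ring
  have tu : IsTame u := IsTame.of_tendsto (fun m hm => if_pos hm) husq
  have noise (m : ℤ) : e m = ∑ i : Fin 1, ρ * shift ((i : ℕ) + 1) e m + u m := by
    simp only [Finset.univ_unique, Finset.sum_singleton, Fin.default_eq_zero, Fin.val_zero,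
      zero_add, shift, Nat.cast_one]
    rcases lt_trichotomy m 0 with hm | rfl | hm
    · simp only [he, hu, if_pos hm, if_pos (show m - 1 < 0 by omega)]; simp
    · simp [he, hu]
    · obtain ⟨n, rfl⟩ : ∃ n : ℕ, m = ((n + 1 : ℕ) : ℤ) := ⟨(m - 1).toNat, by omega⟩
      rw [huv]
      simp only [he]
      rw [if_neg (by omega), if_neg (by omega), Int.toNat_natCast, h.noise _ (by omega)]
      congr 3
      omega
  have te : IsTame e := IsTame.of_recursion (θ := fun _ : Fin 1 => ρ) (by simpa using hρ)
    (fun m hm => if_pos hm) noise tu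
  have process (m : ℤ) :
      cutoff x m = ∑ i, θ i * shift ((i : ℕ) + 1) (cutoff x) m + e m := by
    simp only [shift]
    rcases le_or_gt m 0 with hm | hm
    · rw [Finset.sum_eq_zero fun i _ => by rw [cutoff_of_neg x (by omega), mul_zero], zero_add]
      rcases hm.lt_or_eq with hm | rfl
      · rw [cutoff_of_neg x hm]; exact (if_pos hm).symm
      · rw [cutoff_of_nonneg x le_rfl, h.init_zero]; rfl
    · obtain ⟨n, rfl⟩ : ∃ n : ℕ, m = (n : ℤ) := ⟨m.toNat, by omega⟩
      rw [cutoff_of_nonneg x hm.le, h.process n (by omega)]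
      congr 1
      refine Finset.sum_congr rfl fun i _ => ?_
      rw [h.cutoff_eq (by omega), Nat.cast_add, Nat.cast_one]
  have tx : IsTame (cutoff x) :=
    IsTame.of_recursion hθ (fun m hm => cutoff_of_neg x hm) process te
  rw [tendsto_iff_ultrafilter]
  intro U hU
  have hmodel : IsLimitModel U θ ρ (cutoff x) e u :=
    { le_atTop := hU
      sum_abs_lt := hθ
      abs_lt := hρ
      tame_x := tx
      tame_e := te
      tame_u := tu
      process := process
      noise := noise
      white := fun j => ip_eq_of_tendsto ((hucov j).mono_left hU)
      white_pos := by rwa [ip_eq_of_tendsto (husq.mono_left hU)] }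
  refine tendsto_inv_mulVec (c := fun n : ℕ => (n : ℝ)⁻¹) ?_ (h.tendsto_gramMatrix hU tx S)
    (h.tendsto_sum_smul_lagVector hU tx) hmodel.isUnit_det_limitGram
    hmodel.limitGram_mulVec_thetaStar
  filter_upwards [hU (eventually_gt_atTop 0)] with n hn
  exact inv_ne_zero (by exact_mod_cast (Nat.ne_of_gt hn))

end Trajectory

end ARNoise

theorem mainTheorem5
    {Ω : Type*} [MeasurableSpace Ω] (μ : Measure Ω) [IsProbabilityMeasure μ]
    (p : ℕ) [NeZero p] (θ : Fin p → ℝ) (ρ σ : ℝ)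
    (hθ : ∑ i, |θ i| < 1) (hρ : |ρ| < 1) (hσ : 0 < σ)
    (S : Matrix (Fin p) (Fin p) ℝ) (hS : S.PosDef)
    (X : ℤ → Ω → ℝ) (ε V : ℕ → Ω → ℝ)
    (hVL2 : MemLp (V 1) 2 μ)
    (hVindep : iIndepFun (fun k : ℕ => V (k + 1)) μ)
    (hVident : ∀ k : ℕ, IdentDistrib (V (k + 1)) (V 1) μ μ)
    (hVmean : ∫ ω, V 1 ω ∂μ = 0)
    (hVvar : variance (V 1) μ = σ ^ 2)
    (hX0 : MemLp (X 0) 2 μ)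
    (hX : ∀ᵐ ω ∂μ, ARNoise.IsTrajectory θ ρ (fun m => X m ω) (fun n => ε n ω) (fun n => V n ω)) :
    ∀ᵐ ω ∂μ, Tendsto (fun n : ℕ => ARNoise.lsEstimator S (fun m => X m ω) n) atTop
      (𝓝 (ARNoise.thetaStar θ ρ)) := by
  have hsecond : ∫ ω, V 1 ω * V 1 ω ∂μ = σ ^ 2 := by
    rw [← hVvar, variance_of_integral_eq_zero hVL2.aemeasurable hVmean]
    simp only [sq]
  have hsq := ARNoise.ae_tendsto_average_sq (W := fun k => V (k + 1)) hVL2 hVindep hVident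
  have hcov := ae_all_iff.2 fun j : ℕ => ARNoise.ae_tendsto_average_mul
    (W := fun k => V (k + 1)) hVL2 hVindep hVident hVmean j.succ_pos
  filter_upwards [hX, hsq, hcov] with ω hω hsqω hcovω
  simp only [zero_add, hsecond] at hsqω
  exact hω.tendsto_lsEstimator hθ hρ (pow_pos hσ 2) hsqω hcovω S
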